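/- Let $n=2^k$ be a power of two. The $n$-input FFT DAG has as nodes the pairs $\langle w,l\rangle$ with $0\le w<n$, $0\le l\le \log n$ (all logarithms are to base two), and an arc from $\langle w,l\rangle$ to $\langle w',l'\rangle$ if and only if $l'=l+1$ and either $w=w'$ or the binary representations of $w$ and $w'$ differ exactly in the $l'$-th least significant bit. Its inputs are the nodes of in-degree $0$ and its outputs the nodes of out-degree $0$. A BSP with $p$ processors, each with unbounded local memory, executes a finite sequence of supersteps. In a superstep each processor first performs local operations and then sends messages, which become visible to their receivers at the beginning of the next superstep; a message carries at most one datum (one raw input or the value of one node). A processor can evaluate an input node only if it holds the corresponding raw input, and any other node only if it holds the values of all its predecessors; it can send only data that it holds. The execution evaluates the DAG without recomputation if each node is evaluated exactly once, by one processor. The degree of a superstep is the maximum, over the processors, of the number of messages sent and of the number of messages received by the processor in that superstep, and the BSP communication complexity $H$ is the sum of the degrees of all supersteps. Let $\mathcal A$ be any algorithm that evaluates the $n$-input FFT DAG without recomputation on a BSP with $p\le 2n/e$ processors, such that initially each input is available to exactly one processor, and let $q$ be the maximum number of output nodes evaluated by a processor. Then the BSP communication complexity of $\mathcal A$ satisfies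 \[ H_{\mathcal A}\;\ge\;\frac{n\log\bigl(n/(8q^2)\bigr)}{4p\log(2n/p)}+\frac{\min\{q,n-q\}}{4}. \] Moreover, if $q\le n/2$, then \[ H_{\mathcal A}\;>\;\frac{n\log(n/2)}{8p\log(2n/p)}. \] -/

import Mathlib

/-- A computation DAG: `arc u v` says that the value of `u` is an operand of `v`. -/
structure ComputationDAG (V : Type*) where
  arc : V → V → Prop
  acyclic : ∀ v, ¬ Relation.TransGen arc v v

namespace ComputationDAG

variable {V : Type*}

/-- Inputs are the nodes of in-degree zero. -/
def IsInput (G : ComputationDAG V) (v : V) : Prop := ∀ u, ¬ G.arc u v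

/-- Outputs are the nodes of out-degree zero. -/
def IsOutput (G : ComputationDAG V) (v : V) : Prop := ∀ w, ¬ G.arc v w

end ComputationDAG

/-! ### The FFT DAG on `2 ^ k` inputs -/

/-- A node is a pair `⟨w, l⟩` with `0 ≤ w < 2 ^ k` and `0 ≤ l ≤ k`. -/
abbrev FFTNode (k : ℕ) : Type := Fin (2 ^ k) × Fin (k + 1)

/-- Arcs go from `⟨w, l⟩` to `⟨w', l + 1⟩` where `w = w'`, or `w` and `w'` differ exactly in the
`(l + 1)`-th least significant bit, which `Nat.testBit` (counting from zero) numbers `l`. -/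
def FFTArc (k : ℕ) (a b : FFTNode k) : Prop :=
  (b.2 : ℕ) = (a.2 : ℕ) + 1 ∧
    (a.1 = b.1 ∨
      ∀ i : ℕ, (a.1 : ℕ).testBit i ≠ (b.1 : ℕ).testBit i ↔ i = (a.2 : ℕ))

theorem FFTArc.level_lt_of_transGen {k : ℕ} {a b : FFTNode k}
    (h : Relation.TransGen (FFTArc k) a b) : (a.2 : ℕ) < (b.2 : ℕ) := by
  induction h with
  | single h => have := h.1; omega
  | tail _ h ih => have := h.1; omega

def fftDAG (k : ℕ) : ComputationDAG (FFTNode k) where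
  arc := FFTArc k
  acyclic := fun _ h => lt_irrefl _ (FFTArc.level_lt_of_transGen h)

/-! ### Evaluation of a computation DAG on a BSP with `p` processors -/

namespace BSP

/-- The data of an execution that concern the DAG: the raw datum on which the input operation of
an input node acts, and the value of a node once it has been evaluated. -/
inductive Word (V : Type*) where
  | raw (v : V) : Word V
  | val (v : V) : Word V

/-- A message carries at most one such word; `none` stands for a message that has nothing to do
with the DAG (it still counts as a message). -/
structure Message (p : ℕ) (V : Type*) where
  src : Fin p
  dst : Fin p
  payload : Option (Word V)

/-- One superstep: the nodes evaluated by each processor, in the order of evaluation, and then the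
messages sent. -/
structure Superstep (p : ℕ) (V : Type*) where
  ops : Fin p → List V
  msgs : List (Message p V)

/-- The contents of the (unbounded) local memories. -/
abbrev Memory (p : ℕ) (V : Type*) : Type _ := Fin p → Set (Word V)

section

variable {p : ℕ} {V : Type*}

/-- Node `v` can be evaluated by a processor with memory `M`: an input node needs its raw datum, any
other node needs the values of all its predecessors. -/
def CanEvaluate (G : ComputationDAG V) (M : Set (Word V)) (v : V) : Prop :=
  (G.IsInput v → Word.raw v ∈ M) ∧ ∀ u, G.arc u v → Word.val u ∈ M

/-- The nodes of the list can be evaluated one after the other, starting with memory `M`. -/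
def LocalValid (G : ComputationDAG V) (M : Set (Word V)) : List V → Prop
  | [] => True
  | v :: vs => CanEvaluate G M v ∧ LocalValid G (insert (Word.val v) M) vs

namespace Superstep

/-- The memories after the local computation of the superstep. -/
def afterOps (s : Superstep p V) (M : Memory p V) : Memory p V :=
  fun P => M P ∪ {x | ∃ v ∈ s.ops P, x = Word.val v}

/-- The memories at the beginning of the next superstep, when the messages have become visible. -/
def next (s : Superstep p V) (M : Memory p V) : Memory p V :=
  fun P => s.afterOps M P ∪ {x | ∃ m ∈ s.msgs, m.dst = P ∧ m.payload = some x}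

/-- The superstep can be executed from `M`: operands are in the local memory of the processor
that uses them, and a processor sends only words that it has. -/
def Valid (G : ComputationDAG V) (s : Superstep p V) (M : Memory p V) : Prop :=
  (∀ P, LocalValid G (M P) (s.ops P)) ∧
    ∀ m ∈ s.msgs, ∀ x, m.payload = some x → x ∈ s.afterOps M m.src

/-- The degree: the maximum number of messages sent or received by any processor. -/
def degree (s : Superstep p V) : ℕ :=
  Finset.univ.sup fun P : Fin p =>
    max (s.msgs.countP fun m => m.src = P) (s.msgs.countP fun m => m.dst = P)

end Superstep

/-- The supersteps of the list can be executed one after the other, starting from `M`. -/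
def ValidFrom (G : ComputationDAG V) : Memory p V → List (Superstep p V) → Prop
  | _, [] => True
  | M, s :: ss => s.Valid G M ∧ ValidFrom G (s.next M) ss

end

/-- An execution of a BSP algorithm: `avail P v` says that the raw datum of the input node `v` is
initially available to processor `P`. -/
structure Execution (p : ℕ) (V : Type*) where
  avail : Fin p → V → Prop
  steps : List (Superstep p V)

namespace Execution

variable {p : ℕ} {V : Type*}

def initialMemory (A : Execution p V) : Memory p V :=
  fun P => {x | ∃ v, A.avail P v ∧ x = Word.raw v}

/-- The BSP communication complexity: the sum of the degrees of the supersteps. -/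
def commComplexity (A : Execution p V) : ℕ := (A.steps.map Superstep.degree).sum

/-- How many times node `v` is evaluated, over all supersteps and processors. -/
def evalCount [DecidableEq V] (A : Execution p V) (v : V) : ℕ :=
  (A.steps.map fun s => ∑ P : Fin p, (s.ops P).count v).sum

/-- The execution respects the dependencies of `G` and evaluates every node, possibly with
recomputation. -/
def Evaluates [DecidableEq V] (A : Execution p V) (G : ComputationDAG V) : Prop :=
  ValidFrom G A.initialMemory A.steps ∧ ∀ v, 1 ≤ A.evalCount v

/-- Every node is evaluated exactly once. -/
def EvaluatesWithoutRecomputation [DecidableEq V] (A : Execution p V) (G : ComputationDAG V) :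
    Prop :=
  A.Evaluates G ∧ ∀ v, A.evalCount v = 1

/-- Every input of `G` is initially available to exactly one processor. -/
def InputsAtUniqueProcessor (A : Execution p V) (G : ComputationDAG V) : Prop :=
  ∀ v, G.IsInput v → ∃! P, A.avail P v

/-- The set of output nodes of `G` evaluated by processor `P`. -/
def outputsOf (A : Execution p V) (G : ComputationDAG V) (P : Fin p) : Set V :=
  {v | G.IsOutput v ∧ ∃ s ∈ A.steps, v ∈ s.ops P}

/-- The maximum number of output nodes evaluated by a processor. -/
noncomputable def maxOutputs (A : Execution p V) (G : ComputationDAG V) : ℕ :=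
  Finset.univ.sup fun P : Fin p => (A.outputsOf G P).ncard

end Execution

end BSP

/-! Two lower bounds on `H`, with `n = 2 ^ k`, are combined.

Counting. Place a packet on each of the `2n` arcs leaving level 0 and regard every node of the
levels `1, …, k - 1` as a switch joining its two incoming to its two outgoing arcs. Paths in the FFT
DAG are determined by their ends, so the `2 ^ (n (k - 1))` settings realize distinct permutations of
the packets (`switch_eq_of_route_eq`). An execution without recomputation fixes when and where each
node is evaluated and how each operand travels along its arc. Packets ride with the operands, so
every setting gives an allocation of packets to processors at each time. All settings start from the
same allocation. In a superstep of degree `h` at most `2h` packets leave a processor, as a value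
serves two arcs, and the slots that move do not depend on the setting. Only the identity of the
packets in them does, which multiplies the number of allocations by at most `(2n/p) ^ (2hp)`
(`card_range_alloc_succ_le`). A final allocation leaves at most `2q` final arcs for each packet.
Hence `n log (n/2) ≤ 2pH log (2n/p) + 2n log (2q)` (`Schedule.two_pow_le`, `mul_logb_le`).

Crossing. For each `x` the paths from row `w` to row `w xor x` are node-disjoint. Averaging over `x`
the paths that enter or leave a processor with `q` outputs gives `min q (n - q) / 2 ≤ H`
(`min_le_commComplexity`).

Half of each bound gives the first claim; a case distinction on the size of `q` gives the second
(`fft_bounds_of_logb_bounds`). -/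

/-! ### Executions without recomputation: schedules, trajectories and message counts. -/

namespace BSP

variable {p : ℕ} {V : Type*}

theorem LocalValid.mem_or_mem {G : ComputationDAG V} {u v : V} (huv : G.arc u v) :
    ∀ {l : List V} {M : Set (Word V)}, LocalValid G M l → v ∈ l → Word.val u ∈ M ∨ u ∈ l
  | [], _, _, hv => by simp at hv
  | a :: l, M, h, hv => by
    rcases List.mem_cons.1 hv with rfl | hv
    · exact Or.inl (h.1.2 u huv)
    · rcases LocalValid.mem_or_mem huv h.2 hv with hu | hu
      · rcases Set.mem_insert_iff.1 hu with hu | hu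
        · cases hu
          exact Or.inr List.mem_cons_self
        · exact Or.inl hu
      · exact Or.inr (List.mem_cons_of_mem _ hu)

theorem ValidFrom.valid_getElem {G : ComputationDAG V} :
    ∀ {ss : List (Superstep p V)} {M : Memory p V}, ValidFrom G M ss →
      ∀ t (ht : t < ss.length), ss[t].Valid G ((ss.take t).foldl (fun M s => s.next M) M)
  | [], _, _, t, ht => by simp at ht
  | s :: ss, M, h, 0, _ => h.1
  | s :: ss, M, h, t + 1, ht => by
    simpa using ValidFrom.valid_getElem h.2 t (by simpa using ht)

namespace Execution

variable (A : Execution p V)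

/-- The memories at the beginning of superstep `t`. -/
def memoryAt (t : ℕ) : Memory p V :=
  (A.steps.take t).foldl (fun M s => s.next M) A.initialMemory

/-- Processor `P` evaluates `v` in superstep `t`. -/
def EvaluatedAt (v : V) (t : ℕ) (P : Fin p) : Prop :=
  ∃ h : t < A.steps.length, v ∈ (A.steps[t]).ops P

/-- In superstep `t`, processor `P` sends the value of `u` to processor `Q`. -/
def SendsAt (u : V) (t : ℕ) (P Q : Fin p) : Prop :=
  ∃ h : t < A.steps.length, ∃ m ∈ (A.steps[t]).msgs,
    m.src = P ∧ m.dst = Q ∧ m.payload = some (Word.val u)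

/-- The degree of superstep `t`. -/
def degreeAt (t : ℕ) : ℕ := if h : t < A.steps.length then A.steps[t].degree else 0

theorem sum_degreeAt : ∑ t ∈ Finset.range A.steps.length, A.degreeAt t = A.commComplexity := by
  rw [commComplexity, ← Fin.sum_univ_eq_sum_range, ← Fin.sum_univ_fun_getElem]
  exact Finset.sum_congr rfl fun t _ => dif_pos t.2

theorem memoryAt_succ {t : ℕ} (ht : t < A.steps.length) :
    A.memoryAt (t + 1) = A.steps[t].next (A.memoryAt t) := by
  rw [memoryAt, List.take_succ_eq_append_getElem ht, List.foldl_append]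
  rfl

theorem exists_unique_evaluatedAt [DecidableEq V] {v : V} (hv : A.evalCount v = 1) :
    ∃ t P, ∀ t' P', A.EvaluatedAt v t' P' ↔ t' = t ∧ P' = P := by
  have hsum : ∑ x : Fin A.steps.length × Fin p, (A.steps[x.1].ops x.2).count v = 1 := by
    rw [Fintype.sum_prod_type, ← hv, evalCount, ← Fin.sum_univ_fun_getElem]
    rfl
  obtain ⟨x, -, hx⟩ := Finset.exists_ne_zero_of_sum_ne_zero (hsum.trans_ne one_ne_zero)
  refine ⟨x.1, x.2, fun t P => ⟨?_, ?_⟩⟩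
  · rintro ⟨ht, hm⟩
    by_contra hne
    have hne' : x ≠ (⟨t, ht⟩, P) := by
      rintro rfl
      exact hne ⟨rfl, rfl⟩
    have h1 := Finset.sum_le_sum_of_subset
      (f := fun x : Fin A.steps.length × Fin p => (A.steps[x.1].ops x.2).count v)
      (Finset.subset_univ {x, (⟨t, ht⟩, P)})
    rw [Finset.sum_pair hne', hsum] at h1
    have h2 : 0 < (A.steps[t].ops P).count v := List.count_pos_iff.2 hm
    simp only [Fin.getElem_fin] at h1 hx
    omega
  · rintro ⟨rfl, rfl⟩
    exact ⟨x.1.2, List.count_pos_iff.1 (Nat.pos_of_ne_zero hx)⟩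

section Trajectory

variable {A} {u : V} {s : ℕ} {P₀ : Fin p}

/-- A trajectory of the value of `u` from the processor `P₀` that evaluates `u` in superstep `s` to
processor `Q`, which it reaches by the beginning of superstep `d`. -/
structure IsTrajectory (A : Execution p V) (u : V) (s : ℕ) (P₀ : Fin p) (d : ℕ) (Q : Fin p)
    (L : ℕ → Fin p) : Prop where
  depart : ∀ t ≤ s, L t = P₀
  arrive : ∀ t, d ≤ t → L t = Q
  move : ∀ t, L t ≠ L (t + 1) → A.SendsAt u t (L t) (L (t + 1))

theorem IsTrajectory.send {d : ℕ} {Q R : Fin p} {L : ℕ → Fin p}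
    (hL : A.IsTrajectory u s P₀ d Q L) (hs : s ≤ d) (hsend : A.SendsAt u d Q R) :
    A.IsTrajectory u s P₀ (d + 1) R (fun t => if t ≤ d then L t else R) where
  depart t ht := by
    simp [ht.trans hs, hL.depart t ht]
  arrive t ht := by
    simp [Nat.not_le.2 (Nat.lt_of_succ_le ht)]
  move t ht := by
    rcases lt_trichotomy t d with h | rfl | h
    · have h' : t + 1 ≤ d := h
      simp only [h.le, h', if_true] at ht ⊢
      exact hL.move t ht
    · simpa [hL.arrive t le_rfl] using hsend
    · simp [Nat.not_le.2 h, Nat.not_le.2 (h.trans (Nat.lt_succ_self t))] at ht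

theorem IsTrajectory.exists_sendsAt_of_ne {d : ℕ} {Q : Fin p} {L : ℕ → Fin p}
    (hL : A.IsTrajectory u s P₀ d Q L) (hs : s ≤ d) (c : Fin p → Prop) (hP : c P₀) (hQ : ¬ c Q) :
    ∃ t R R', c R ∧ ¬ c R' ∧ A.SendsAt u t R R' := by
  by_contra! hcon
  have : ∀ t, s ≤ t → c (L t) := fun t ht => by
    induction t, ht using Nat.le_induction with
    | base => rwa [hL.depart s le_rfl]
    | succ t _ ih =>
      by_contra hc
      exact hcon t _ _ ih hc (hL.move t fun h => hc (h ▸ ih))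
  exact hQ (hL.arrive d le_rfl ▸ this d hs)

/-- A value in memory can be traced back through messages to an evaluation, and `hu` leaves only one
place where the trace can end. -/
theorem exists_isTrajectory_of_mem {G : ComputationDAG V}
    (hA : ValidFrom G A.initialMemory A.steps)
    (hu : ∀ t P, A.EvaluatedAt u t P → t = s ∧ P = P₀) (d : ℕ) :
    ∀ Q, d ≤ A.steps.length → Word.val u ∈ A.memoryAt d Q →
      s < d ∧ ∃ L, A.IsTrajectory u s P₀ d Q L := by
  induction d with
  | zero =>
    intro Q _ h
    simp [memoryAt, initialMemory] at h
  | succ d ih =>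
    intro Q hd h
    have hd' : d < A.steps.length := hd
    have key : ∀ R, Word.val u ∈ A.steps[d].afterOps (A.memoryAt d) R →
        s ≤ d ∧ ∃ L, A.IsTrajectory u s P₀ d R L := by
      rintro R (hR | ⟨v, hv, hvu⟩)
      · obtain ⟨h1, h2⟩ := ih R hd'.le hR
        exact ⟨h1.le, h2⟩
      · cases hvu
        obtain ⟨rfl, rfl⟩ := hu d R ⟨hd', hv⟩
        exact ⟨le_rfl, fun _ => R, fun _ _ => rfl, fun _ _ => rfl, fun _ h => absurd rfl h⟩
    rw [memoryAt_succ A hd'] at h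
    rcases h with h | ⟨m, hm, hdst, hpay⟩
    · obtain ⟨h1, L, hL⟩ := key Q h
      exact ⟨Nat.lt_succ_of_le h1, L, hL.depart, fun t ht => hL.arrive t (Nat.le_of_succ_le ht),
        hL.move⟩
    · obtain ⟨h1, L, hL⟩ := key m.src ((hA.valid_getElem d hd').2 m hm _ hpay)
      exact ⟨Nat.lt_succ_of_le h1, _, hL.send h1 ⟨hd', m, hm, rfl, hdst, hpay⟩⟩

end Trajectory

/-- An evaluation without recomputation assigns to each node `v` the superstep `τ v` and the
processor `π v` of its evaluation, and every arc has a trajectory of its operand. -/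
theorem exists_schedule [DecidableEq V] {A : Execution p V} {G : ComputationDAG V}
    (hA : A.EvaluatesWithoutRecomputation G) :
    ∃ (τ : V → ℕ) (π : V → Fin p),
      (∀ v t P, A.EvaluatedAt v t P ↔ t = τ v ∧ P = π v) ∧
      ∀ u v, G.arc u v → τ u ≤ τ v ∧ ∃ L, A.IsTrajectory u (τ u) (π u) (τ v) (π v) L := by
  choose τ π h using fun v => A.exists_unique_evaluatedAt (hA.2 v)
  refine ⟨τ, π, h, fun u v huv => ?_⟩
  obtain ⟨ht, hv⟩ := (h v (τ v) (π v)).2 ⟨rfl, rfl⟩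
  rcases ((hA.1.1.valid_getElem _ ht).1 (π v)).mem_or_mem huv hv with hu | hu
  · obtain ⟨h1, h2⟩ := exists_isTrajectory_of_mem hA.1.1 (fun t P => (h u t P).1) (τ v) (π v)
      ht.le hu
    exact ⟨h1.le, h2⟩
  · obtain ⟨h1, h2⟩ := (h u _ _).1 ⟨ht, hu⟩
    rw [h1, h2]
    exact ⟨le_rfl, fun _ => π u, fun _ _ => rfl, fun _ _ => rfl, fun _ h => absurd rfl h⟩

/-- A message carries one word, so distinct values need distinct messages. Taking `f` to be `src` or
`dst` covers both sending and receiving. -/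
theorem card_le_of_exists_payload {ms : List (Message p V)} (S : Finset V)
    (f : Message p V → Fin p) (P : Fin p)
    (hS : ∀ u ∈ S, ∃ m ∈ ms, f m = P ∧ m.payload = some (Word.val u)) :
    S.card ≤ ms.countP fun m => f m = P := by
  classical
  rw [List.countP_eq_length_filter]
  calc S.card = (S.image fun u => some (Word.val u)).card := by
        rw [Finset.card_image_of_injective]
        intro a b hab
        simpa using hab
    _ ≤ ((ms.filter fun m => f m = P).map Message.payload).toFinset.card := by
        refine Finset.card_le_card fun x hx => ?_
        obtain ⟨u, hu, rfl⟩ := Finset.mem_image.1 hx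
        obtain ⟨m, hm, h1, h2⟩ := hS u hu
        simp only [List.mem_toFinset, List.mem_map, List.mem_filter]
        exact ⟨m, ⟨hm, by simpa using h1⟩, h2⟩
    _ ≤ _ := (List.toFinset_card_le _).trans (by simp)

theorem countP_le_degree (s : Superstep p V) (P : Fin p) :
    (s.msgs.countP fun m => m.src = P) ≤ s.degree ∧
      (s.msgs.countP fun m => m.dst = P) ≤ s.degree := by
  have h := Finset.le_sup (f := fun P : Fin p =>
    max (s.msgs.countP fun m => m.src = P) (s.msgs.countP fun m => m.dst = P)) (Finset.mem_univ P)
  exact ⟨(le_max_left _ _).trans h, (le_max_right _ _).trans h⟩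

theorem card_sent_le_degreeAt (S : Finset V) (t : ℕ) (P : Fin p)
    (hS : ∀ u ∈ S, ∃ Q, A.SendsAt u t P Q) : S.card ≤ A.degreeAt t := by
  by_cases ht : t < A.steps.length
  · rw [degreeAt, dif_pos ht]
    refine (card_le_of_exists_payload S Message.src P fun u hu => ?_).trans
      (countP_le_degree _ P).1
    obtain ⟨Q, _, m, hm, h1, _, h3⟩ := hS u hu
    exact ⟨m, hm, h1, h3⟩
  · rcases S.eq_empty_or_nonempty with rfl | ⟨u, hu⟩
    · simp
    · obtain ⟨Q, h, _⟩ := hS u hu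
      exact absurd h ht

theorem card_le_commComplexity (S : Finset V) (f : Message p V → Fin p) (P : Fin p)
    (hf : ∀ s : Superstep p V, (s.msgs.countP fun m => f m = P) ≤ s.degree)
    (hS : ∀ u ∈ S, ∃ s ∈ A.steps, ∃ m ∈ s.msgs, f m = P ∧ m.payload = some (Word.val u)) :
    S.card ≤ A.commComplexity := by
  have h := card_le_of_exists_payload (ms := A.steps.flatMap Superstep.msgs) S f P (by
    intro u hu
    obtain ⟨s, hs, m, hm, h⟩ := hS u hu
    exact ⟨m, List.mem_flatMap.2 ⟨s, hs, hm⟩, h⟩)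
  refine h.trans ?_
  rw [List.countP_flatMap, commComplexity]
  exact List.sum_le_sum fun s _ => hf s

theorem card_sent_le_commComplexity (S : Finset V) (P : Fin p)
    (hS : ∀ u ∈ S, ∃ t Q, A.SendsAt u t P Q) : S.card ≤ A.commComplexity := by
  refine A.card_le_commComplexity S Message.src P (fun s => (countP_le_degree s P).1) fun u hu => ?_
  obtain ⟨t, Q, ht, m, hm, h1, _, h3⟩ := hS u hu
  exact ⟨_, List.getElem_mem ht, m, hm, h1, h3⟩

theorem card_received_le_commComplexity (S : Finset V) (P : Fin p)
    (hS : ∀ u ∈ S, ∃ t Q, A.SendsAt u t Q P) : S.card ≤ A.commComplexity := by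
  refine A.card_le_commComplexity S Message.dst P (fun s => (countP_le_degree s P).2) fun u hu => ?_
  obtain ⟨t, Q, ht, m, hm, _, h2, h3⟩ := hS u hu
  exact ⟨_, List.getElem_mem ht, m, hm, h2, h3⟩

end Execution

end BSP

/-! ### Paths in the FFT DAG -/

namespace FFT

variable {k : ℕ}

/-- Bitwise exclusive or of `w` with the `k` low-order bits of `x`. -/
def xorBits (w : Fin (2 ^ k)) (x : ℕ) : Fin (2 ^ k) :=
  ⟨((w : ℕ) ^^^ x) % 2 ^ k, Nat.mod_lt _ (by positivity)⟩

theorem testBit_xorBits (w : Fin (2 ^ k)) (x i : ℕ) :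
    (xorBits w x : ℕ).testBit i = (decide (i < k) && ((w : ℕ).testBit i ^^ x.testBit i)) := by
  simp [xorBits, Nat.testBit_mod_two_pow]

theorem testBit_eq_false (w : Fin (2 ^ k)) {i : ℕ} (hi : k ≤ i) : (w : ℕ).testBit i = false :=
  Nat.testBit_lt_two_pow (w.2.trans_le (Nat.pow_le_pow_right (by norm_num) hi))

theorem ext_testBit {w w' : Fin (2 ^ k)}
    (h : ∀ i < k, (w : ℕ).testBit i = (w' : ℕ).testBit i) : w = w' := by
  refine Fin.ext (Nat.eq_of_testBit_eq fun i => ?_)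
  rcases lt_or_ge i k with hi | hi
  · exact h i hi
  · rw [testBit_eq_false w hi, testBit_eq_false w' hi]

theorem xorBits_xorBits (w : Fin (2 ^ k)) (x : ℕ) : xorBits (xorBits w x) x = w := by
  refine ext_testBit fun i hi => ?_
  simp [testBit_xorBits, hi]

theorem xorBits_injective (x : ℕ) : Function.Injective fun w : Fin (2 ^ k) => xorBits w x :=
  fun a b h => by
    rw [← xorBits_xorBits a x, ← xorBits_xorBits b x]
    exact congrArg (fun w => xorBits w x) h

theorem xorBits_zero (w : Fin (2 ^ k)) : xorBits w 0 = w := by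
  refine ext_testBit fun i hi => ?_
  simp [testBit_xorBits, hi]

theorem xorBits_left_injective (w : Fin (2 ^ k)) :
    Function.Injective fun c : Fin (2 ^ k) => xorBits w c := fun a b h => by
  refine ext_testBit fun i hi => ?_
  have := congrArg (fun v : Fin (2 ^ k) => (v : ℕ).testBit i) h
  simpa [testBit_xorBits, hi] using this

/-- The row reached from row `w` at level `l` along the straight arc (`b = false`) or along the cross
arc (`b = true`). -/
def arcTo (l : ℕ) (w : Fin (2 ^ k)) (b : Bool) : Fin (2 ^ k) :=
  if b then xorBits w (2 ^ l) else w

theorem testBit_arcTo (l : ℕ) (w : Fin (2 ^ k)) (b : Bool) {i : ℕ} (hi : i < k) :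
    (arcTo l w b : ℕ).testBit i = ((w : ℕ).testBit i ^^ (b && decide (l = i))) := by
  cases b <;> simp [arcTo, testBit_xorBits, hi, Nat.testBit_two_pow]

theorem arcTo_injective (l : ℕ) (b : Bool) :
    Function.Injective fun w : Fin (2 ^ k) => arcTo l w b := by
  cases b
  · exact fun _ _ h => h
  · exact xorBits_injective _

theorem fftArc_arcTo {l : ℕ} (hl : l < k) (w : Fin (2 ^ k)) (b : Bool) :
    FFTArc k (w, ⟨l, by omega⟩) (arcTo l w b, ⟨l + 1, by omega⟩) := by
  refine ⟨rfl, ?_⟩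
  cases b
  · exact Or.inl rfl
  · refine Or.inr fun i => ?_
    rcases lt_or_ge i k with hi | hi
    · rw [testBit_arcTo l w true hi]
      by_cases h : l = i
      · simp [h]
      · simp [h, Ne.symm h]
    · simp only [testBit_eq_false _ hi]
      simp
      omega

theorem xorBits_mod_two_pow_succ (w : Fin (2 ^ k)) (c l : ℕ) :
    xorBits w (c % 2 ^ (l + 1)) = arcTo l (xorBits w (c % 2 ^ l)) (c.testBit l) := by
  refine ext_testBit fun i hi => ?_
  simp only [testBit_arcTo _ _ _ hi, testBit_xorBits, hi, Nat.testBit_mod_two_pow]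
  rcases lt_trichotomy i l with h | rfl | h
  · simp [h, h.trans (Nat.lt_succ_self l), h.ne']
  · simp
  · simp [h.ne, Nat.not_lt.2 h.le, Nat.not_lt.2 (Nat.succ_le_of_lt h)]

/-! ### Routing packets through switches -/

/-- The switch at row `w` of level `l + 1`, which is crossed if `σ l w`, moves packets from the arcs
that leave level `l` to those that leave level `l + 1`. -/
def switchStep (σ : ℕ → Fin (2 ^ k) → Bool) (l : ℕ) (a : Fin (2 ^ k) × Bool) :
    Fin (2 ^ k) × Bool :=
  (arcTo l a.1 a.2, a.2 ^^ σ l (arcTo l a.1 a.2))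

/-- The arc from level `l` to level `l + 1` on which the packet travels that starts on the arc `a`
leaving level `0`. -/
def route (σ : ℕ → Fin (2 ^ k) → Bool) (a : Fin (2 ^ k) × Bool) : ℕ → Fin (2 ^ k) × Bool
  | 0 => a
  | l + 1 => switchStep σ l (route σ a l)

theorem switchStep_injective (σ : ℕ → Fin (2 ^ k) → Bool) (l : ℕ) :
    Function.Injective (switchStep σ l) := by
  rintro ⟨w, b⟩ ⟨w', b'⟩ h
  obtain ⟨h1, h2⟩ := Prod.ext_iff.1 h
  simp only [switchStep] at h1 h2
  rw [h1] at h2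
  obtain rfl : b = b' := by simpa using h2
  rw [arcTo_injective l b h1]

theorem route_injective (σ : ℕ → Fin (2 ^ k) → Bool) (l : ℕ) :
    Function.Injective fun a => route σ a l := by
  induction l with
  | zero => exact fun _ _ h => h
  | succ l ih => exact (switchStep_injective σ l).comp ih

theorem route_surjective (σ : ℕ → Fin (2 ^ k) → Bool) (l : ℕ) :
    Function.Surjective fun a => route σ a l :=
  Finite.surjective_of_injective (route_injective σ l)

theorem testBit_route_of_le (σ : ℕ → Fin (2 ^ k) → Bool) (a : Fin (2 ^ k) × Bool) {i : ℕ}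
    (hi : i < k) {l : ℕ} (hl : l ≤ i) :
    ((route σ a l).1 : ℕ).testBit i = (a.1 : ℕ).testBit i := by
  induction l with
  | zero => rfl
  | succ l ih =>
    rw [route, switchStep, testBit_arcTo _ _ _ hi, ih (by omega)]
    simp [show l ≠ i by omega]

theorem testBit_route_of_lt (σ : ℕ → Fin (2 ^ k) → Bool) (a : Fin (2 ^ k) × Bool) {i l m : ℕ}
    (hi : i < k) (hl : i < l) (hm : l ≤ m) :
    ((route σ a m).1 : ℕ).testBit i = ((route σ a l).1 : ℕ).testBit i := by
  induction m, hm using Nat.le_induction with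
  | base => rfl
  | succ m hm ih =>
    rw [route, switchStep, testBit_arcTo _ _ _ hi, ih]
    simp [show m ≠ i by omega]

/-- Arcs leaving level `i` change only bit `i`. At level `l` the bits from `l` on are therefore
still the initial ones, and those below `l` are already final. -/
theorem route_fst_eq {σ σ' : ℕ → Fin (2 ^ k) → Bool} {a : Fin (2 ^ k) × Bool} {l m : ℕ}
    (hlm : l ≤ m) (h : (route σ a m).1 = (route σ' a m).1) :
    (route σ a l).1 = (route σ' a l).1 := by
  refine ext_testBit fun i hi => ?_
  rcases le_or_gt l i with hl | hl
  · rw [testBit_route_of_le _ _ hi hl, testBit_route_of_le _ _ hi hl]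
  · rw [← testBit_route_of_lt _ _ hi hl hlm, h, testBit_route_of_lt _ _ hi hl hlm]

theorem route_eq {σ σ' : ℕ → Fin (2 ^ k) → Bool} {a : Fin (2 ^ k) × Bool} {l m : ℕ}
    (hlm : l ≤ m) (hmk : m ≤ k) (h : route σ a m = route σ' a m) : route σ a l = route σ' a l := by
  rcases hlm.eq_or_lt with rfl | hlt
  · exact h
  · have h1 := route_fst_eq hlm (congrArg Prod.fst h)
    have h2 := route_fst_eq (Nat.succ_le_of_lt hlt) (congrArg Prod.fst h)
    refine Prod.ext h1 ?_
    have h3 := congrArg (fun w : Fin (2 ^ k) => (w : ℕ).testBit l) h2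
    simpa [route, switchStep, testBit_arcTo _ _ _ (hlt.trans_le hmk), h1] using h3

/-- The settings of the switches of levels `1, …, m` are determined by the permutation that they
realize. -/
theorem switch_eq_of_route_eq {σ σ' : ℕ → Fin (2 ^ k) → Bool} {m : ℕ} (hmk : m ≤ k)
    (h : ∀ a, route σ a m = route σ' a m) {l : ℕ} (hl : l < m) (w : Fin (2 ^ k)) :
    σ l w = σ' l w := by
  obtain ⟨a, ha⟩ := route_surjective σ (l + 1) (w, false)
  have h1 := route_eq hl.le hmk (h a)
  have h2 := route_eq (Nat.succ_le_of_lt hl) hmk (h a)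
  have hw : arcTo l (route σ a l).1 (route σ a l).2 = w := congrArg Prod.fst ha
  have h3 := congrArg Prod.snd h2
  simp only [route, switchStep, ← h1, hw] at h3
  simpa using h3

end FFT

/-! ### Counting the allocations of packets to processors -/

section Allocations

open Finset

theorem natCast_pow_le_exp_mul_log {m c : ℕ} (hmc : m ≤ c) (N : ℕ) :
    (N : ℝ) ^ m ≤ Real.exp (c * Real.log N) := by
  rcases Nat.eq_zero_or_pos N with rfl | hN
  · simpa using pow_le_one₀ (n := m) (le_refl (0 : ℝ)) zero_le_one
  · have hN' : (1 : ℝ) ≤ N := by exact_mod_cast hN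
    rw [mul_comm, ← Real.rpow_def_of_pos (by linarith), Real.rpow_natCast]
    exact pow_le_pow_right₀ hN' hmc

/-- Concavity of `log`, through its tangent at the mean `c / card ι`. Terms with `N i = 0`
contribute `Real.log 0 = 0`; the tangent stays above them because the mean is at least `e`. This is
how the bound `p ≤ 2n/e` enters the counting. -/
theorem sum_log_natCast_le {ι : Type*} [Fintype ι] (N : ι → ℕ) {c : ℝ}
    (hsum : ∑ i, (N i : ℝ) = c) (hc : (Fintype.card ι : ℝ) ≤ c / Real.exp 1) :
    ∑ i, Real.log (N i) ≤ Fintype.card ι * Real.log (c / Fintype.card ι) := by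
  rcases isEmpty_or_nonempty ι with _ | _
  · simp
  have hι : (0 : ℝ) < Fintype.card ι := by exact_mod_cast Fintype.card_pos
  have he := Real.exp_pos 1
  have h1 : Real.exp 1 ≤ c / Fintype.card ι := by
    rw [le_div_iff₀ hι, mul_comm]
    rwa [le_div_iff₀ he] at hc
  have hc0 : 0 < c := by
    have := he.trans_le h1
    rwa [div_pos_iff_of_pos_right hι] at this
  have hlog : 1 ≤ Real.log (c / Fintype.card ι) := by
    rwa [Real.le_log_iff_exp_le (he.trans_le h1)]
  calc ∑ i, Real.log (N i)
      ≤ ∑ i, (Real.log (c / Fintype.card ι) + (N i * (Fintype.card ι / c) - 1)) := by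
        refine sum_le_sum fun i _ => ?_
        rcases Nat.eq_zero_or_pos (N i) with h | h
        · rw [h]
          simp only [Nat.cast_zero, Real.log_zero, zero_mul]
          linarith
        · have hN : (0 : ℝ) < N i := by exact_mod_cast h
          have h2 := Real.log_le_sub_one_of_pos (x := N i * (Fintype.card ι / c)) (by positivity)
          have h3 : Real.log (N i * (Fintype.card ι / c)) =
              Real.log (N i) - Real.log (c / Fintype.card ι) := by
            rw [← Real.log_div hN.ne' (by positivity)]
            congr 1
            field_simp
          linarith
    _ = _ := by
        rw [sum_add_distrib, sum_sub_distrib, ← sum_mul, hsum]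
        simp only [sum_const, card_univ, nsmul_eq_mul]
        field_simp
        ring

/-- If each processor releases at most `c` of the packets, there are few ways to choose them. -/
theorem prod_card_fiber_le {I S : Type*} [Fintype I] [Fintype S] {p : ℕ} (src : S → Fin p)
    (β : I → Fin p) {c : ℕ} (hc : ∀ P, #{a | src a = P} ≤ c)
    (hp : (p : ℝ) ≤ Fintype.card I / Real.exp 1) :
    ∏ a, (#{i | β i = src a} : ℝ) ≤ Real.exp (c * (p * Real.log (Fintype.card I / p))) := by
  calc ∏ a, (#{i | β i = src a} : ℝ)
      = ∏ P, (#{i | β i = P} : ℝ) ^ #{a | src a = P} := by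
        rw [← prod_fiberwise univ src]
        refine prod_congr rfl fun P _ => ?_
        rw [← prod_const]
        refine prod_congr rfl fun a ha => ?_
        rw [(mem_filter.1 ha).2]
    _ ≤ ∏ P, Real.exp (c * Real.log (#{i | β i = P} : ℕ)) :=
        prod_le_prod (fun _ _ => by positivity) fun P _ => natCast_pow_le_exp_mul_log (hc P) _
    _ = Real.exp (c * ∑ P, Real.log (#{i | β i = P} : ℕ)) := by
        rw [← Real.exp_sum, mul_sum]
    _ ≤ _ := by
        have h := sum_log_natCast_le (fun P : Fin p => #{i | β i = P})
          (c := Fintype.card I) (by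
            rw [← Nat.cast_sum, ← card_eq_sum_card_fiberwise (fun _ _ => mem_univ _), card_univ])
          (by simpa using hp)
        rw [Fintype.card_fin] at h
        gcongr

/-- Allocations `α' σ` that arise from `α σ` by moving one packet from `src a` to `dst a` for each
slot `a`, where the packet `g σ a` depends on `σ`. -/
theorem card_image_le_of_moves {Sig I S : Type*} [Fintype Sig] [Fintype I] [Fintype S] {p : ℕ}
    {α α' : Sig → I → Fin p} {src dst : S → Fin p} {g : Sig → S → I}
    (hsrc : ∀ σ a, α σ (g σ a) = src a) (hdst : ∀ σ a, α' σ (g σ a) = dst a)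
    (hstay : ∀ σ i, (∀ a, g σ a ≠ i) → α' σ i = α σ i) {B : ℝ}
    (hB : ∀ β : I → Fin p, ∏ a, (#{i | β i = src a} : ℝ) ≤ B) :
    (Nat.card (Set.range α') : ℝ) ≤ Nat.card (Set.range α) * B := by
  classical
  -- The new allocation is encoded by the old one and the packet in each slot. If several slots name
  -- the same packet, `hdst` makes the chosen slot irrelevant.
  let F : (Σ β : Set.range α, ∀ a, {i // β.1 i = src a}) → I → Fin p := fun x i =>
    if h : ∃ a, (x.2 a : I) = i then dst h.choose else x.1.1 i
  have hF : Set.range α' ⊆ Set.range F := by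
    rintro _ ⟨σ, rfl⟩
    refine ⟨⟨⟨α σ, σ, rfl⟩, fun a => ⟨g σ a, hsrc σ a⟩⟩, funext fun i => ?_⟩
    by_cases h : ∃ a, g σ a = i
    · simp only [F, dif_pos h]
      rw [← hdst σ, h.choose_spec]
    · simp only [F, dif_neg h]
      exact (hstay σ i (not_exists.1 h)).symm
  have h1 : Nat.card (Set.range α') ≤ Nat.card (Set.range F) :=
    Nat.card_mono (Set.toFinite _) hF
  have h2 : (Nat.card (Set.range F) : ℝ) ≤ ∑ β : Set.range α, ∏ a, (#{i | β.1 i = src a} : ℝ) := by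
    refine (Nat.cast_le.2 (Finite.card_range_le F)).trans_eq ?_
    simp only [Nat.card_eq_fintype_card, Fintype.card_sigma, Fintype.card_pi, Fintype.card_subtype]
    push_cast
    rfl
  calc (Nat.card (Set.range α') : ℝ) ≤ ∑ β : Set.range α, ∏ a, (#{i | β.1 i = src a} : ℝ) :=
        (Nat.cast_le.2 h1).trans h2
    _ ≤ ∑ _β : Set.range α, B := sum_le_sum fun β _ => hB β.1
    _ = _ := by simp [Nat.card_eq_fintype_card]

end Allocations

/-! ### Packets carried by a schedule, and the number of their allocations. -/

namespace FFT

open Finset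

/-- An assignment of times and processors to the nodes of the FFT DAG, with trajectories of the
operands along the arcs. -/
structure Schedule (k p : ℕ) where
  time : Fin (2 ^ k) → ℕ → ℕ
  proc : Fin (2 ^ k) → ℕ → Fin p
  loc : ℕ → ℕ → Fin (2 ^ k) × Bool → Fin p
  time_le : ∀ l < k, ∀ w b, time w l ≤ time (arcTo l w b) (l + 1)
  loc_of_le : ∀ l < k, ∀ w b, ∀ t ≤ time w l, loc t l (w, b) = proc w l
  loc_of_ge : ∀ l < k, ∀ w b t, time (arcTo l w b) (l + 1) ≤ t →
    loc t l (w, b) = proc (arcTo l w b) (l + 1)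

namespace Schedule

variable {m p : ℕ} (s : Schedule (m + 1) p) (σ : ℕ → Fin (2 ^ (m + 1)) → Bool)
  (a : Fin (2 ^ (m + 1)) × Bool)

/-- The level that the arc leaves on which the packet `a` is at time `t`. -/
def curLevel (t : ℕ) : ℕ := Nat.findGreatest (fun l => s.time (route σ a l).1 l < t) m

/-- The processor that holds the packet `a` at time `t`. -/
def alloc (t : ℕ) : Fin p := s.loc t (s.curLevel σ a t) (route σ a (s.curLevel σ a t))

theorem curLevel_le (t : ℕ) : s.curLevel σ a t ≤ m := Nat.findGreatest_le m

theorem time_route_mono {l l' : ℕ} (h : l ≤ l') (hl' : l' ≤ m + 1) :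
    s.time (route σ a l).1 l ≤ s.time (route σ a l').1 l' := by
  induction l', h using Nat.le_induction with
  | base => exact le_rfl
  | succ l' h ih => exact (ih (by omega)).trans (s.time_le l' (by omega) _ _)

/-- `a` is an arc leaving level `l` that may hold a packet at time `t`. -/
def IsCurrent (t l : ℕ) (a : Fin (2 ^ (m + 1)) × Bool) : Prop :=
  l ≤ m ∧ (l ≠ 0 → s.time a.1 l < t) ∧ (l < m → t ≤ s.time (arcTo l a.1 a.2) (l + 1))

/-- Which arcs hold packets at time `t` depends on the schedule alone. As `route` is bijective at
each level, `σ` decides only which packet is on a current arc. -/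
theorem isCurrent_iff (t l : ℕ) :
    s.IsCurrent t l (route σ a l) ↔ s.curLevel σ a t = l := by
  rw [curLevel, Nat.findGreatest_eq_iff, IsCurrent]
  refine and_congr_right fun hl => and_congr_right fun _ => ⟨fun h l' h1 h2 => ?_, fun h hlt => ?_⟩
  · have h3 := s.time_route_mono σ a (Nat.succ_le_of_lt h1) (by omega)
    exact not_lt.2 ((h (by omega)).trans h3)
  · exact not_lt.1 (h (l.lt_succ_self) hlt)

/-- A packet may pass several levels within superstep `t`, but all nodes it passes are evaluated at
time exactly `t`, hence on one processor. The packet can thus be moved to its next arc before the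
messages are sent, and a change of processor becomes a move along a single arc. -/
theorem alloc_eq (t : ℕ) :
    s.alloc σ a t = s.loc t (s.curLevel σ a (t + 1)) (route σ a (s.curLevel σ a (t + 1))) := by
  have hle : s.curLevel σ a t ≤ s.curLevel σ a (t + 1) :=
    Nat.findGreatest_mono_left (fun l h => Nat.lt_succ_of_lt h) m
  have hm := s.curLevel_le σ a (t + 1)
  have h1 := ((s.isCurrent_iff σ a t _).2 rfl).2.2
  have h2 := ((s.isCurrent_iff σ a (t + 1) _).2 rfl).2.1
  rw [alloc]
  generalize s.curLevel σ a t = l at *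
  generalize s.curLevel σ a (t + 1) = l' at *
  suffices h : ∀ j, l ≤ j → j ≤ l' → s.loc t l (route σ a l) = s.loc t j (route σ a j) from
    h l' hle le_rfl
  intro j hj
  induction j, hj using Nat.le_induction with
  | base => exact fun _ => rfl
  | succ j hj ih =>
    intro hjl
    rw [ih (by omega)]
    have h3 : s.time (route σ a (j + 1)).1 (j + 1) ≤ t :=
      (s.time_route_mono σ a hjl (by omega)).trans (Nat.le_of_lt_succ (h2 (by omega)))
    have h4 : t ≤ s.time (route σ a (j + 1)).1 (j + 1) :=
      (h1 (by omega)).trans (s.time_route_mono σ a (Nat.succ_le_succ hj) (by omega))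
    exact (s.loc_of_ge j (by omega) _ _ t h3).trans
      (s.loc_of_le (j + 1) (by omega) _ (route σ a (j + 1)).2 t h4).symm

theorem alloc_zero : s.alloc σ a 0 = s.proc a.1 0 := by
  have h : s.curLevel σ a 0 = 0 := by
    rw [← isCurrent_iff]
    exact ⟨Nat.zero_le _, fun h => absurd rfl h, fun _ => Nat.zero_le _⟩
  rw [alloc, h]
  exact s.loc_of_le 0 (by omega) _ a.2 0 (Nat.zero_le _)

theorem alloc_of_forall_lt {t : ℕ} (ht : ∀ w, ∀ l ≤ m + 1, s.time w l < t) :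
    s.alloc σ a t = s.proc (arcTo m (route σ a m).1 (route σ a m).2) (m + 1) := by
  have h : s.curLevel σ a t = m := by
    rw [← isCurrent_iff]
    exact ⟨le_rfl, fun _ => ht _ _ (by omega), fun h => absurd h (lt_irrefl _)⟩
  rw [alloc, h]
  exact s.loc_of_ge m (by omega) _ _ t (ht _ _ le_rfl).le

/-- Settings of the switches of levels `1, …, m`, extended by uncrossed switches. -/
def extend (σ : Fin m → Fin (2 ^ (m + 1)) → Bool) (l : ℕ) (w : Fin (2 ^ (m + 1))) : Bool :=
  if h : l < m then σ ⟨l, h⟩ w else false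

theorem route_extend_injective :
    Function.Injective fun (σ : Fin m → Fin (2 ^ (m + 1)) → Bool) a => route (extend σ) a m := by
  intro σ σ' h
  funext l w
  have := switch_eq_of_route_eq (Nat.le_succ m) (fun a => congrFun h a) l.2 w
  simpa [extend] using this

variable {s}

theorem card_range_alloc_succ_le {c t : ℕ}
    (hc : ∀ P, #{a : Fin (m + 1) × Fin (2 ^ (m + 1)) × Bool |
      s.loc t a.1 a.2 = P ∧ s.loc (t + 1) a.1 a.2 ≠ P} ≤ c)
    (hp : (p : ℝ) ≤ 2 * 2 ^ (m + 1) / Real.exp 1) :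
    (Nat.card (Set.range fun (σ : Fin m → Fin (2 ^ (m + 1)) → Bool) a =>
        s.alloc (extend σ) a (t + 1)) : ℝ) ≤
      Nat.card (Set.range fun (σ : Fin m → Fin (2 ^ (m + 1)) → Bool) a =>
        s.alloc (extend σ) a t) * Real.exp (c * (p * Real.log (2 * 2 ^ (m + 1) / p))) := by
  classical
  -- The slots are the current arcs whose operand changes processor; they do not mention `σ`. Below,
  -- `g σ x` is the packet that `σ` puts on the arc `x`.
  let S := {x : Fin (m + 1) × Fin (2 ^ (m + 1)) × Bool //
    s.IsCurrent (t + 1) x.1 x.2 ∧ s.loc (t + 1) x.1 x.2 ≠ s.loc t x.1 x.2}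
  choose g hg using fun (σ : Fin m → Fin (2 ^ (m + 1)) → Bool) (x : S) =>
    route_surjective (extend σ) x.1.1 x.1.2
  have hcur : ∀ σ x, s.curLevel (extend σ) (g σ x) (t + 1) = x.1.1 := fun σ x => by
    have h : route (extend σ) (g σ x) x.1.1 = x.1.2 := hg σ x
    rw [← isCurrent_iff, h]
    exact x.2.1
  have hcard : (Fintype.card (Fin (2 ^ (m + 1)) × Bool) : ℝ) = 2 * 2 ^ (m + 1) := by
    simp [mul_comm]
  rw [← hcard] at hp ⊢
  refine card_image_le_of_moves (g := g) (src := fun x => s.loc t x.1.1 x.1.2)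
    (dst := fun x => s.loc (t + 1) x.1.1 x.1.2) (fun σ x => ?_) (fun σ x => ?_) (fun σ a ha => ?_)
    fun β => prod_card_fiber_le _ β (fun P => ?_) hp
  · rw [alloc_eq, hcur]
    exact congrArg _ (hg σ x)
  · rw [alloc, hcur]
    exact congrArg _ (hg σ x)
  · rw [s.alloc_eq (extend σ) a t, alloc]
    by_contra hne
    have hlt := Nat.lt_succ_of_le (s.curLevel_le (extend σ) a (t + 1))
    let x : S := ⟨(⟨_, hlt⟩, route (extend σ) a _), (s.isCurrent_iff _ _ _ _).2 rfl, hne⟩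
    exact ha x (route_injective (extend σ) _ (hg σ x))
  · refine le_trans (card_le_card_of_injOn Subtype.val (fun x hx => ?_)
      Subtype.val_injective.injOn) (hc P)
    have hx' : s.loc t x.1.1 x.1.2 = P := (mem_filter.1 hx).2
    simp only [coe_filter, mem_univ, true_and, Set.mem_ofPred_eq]
    exact ⟨hx', hx' ▸ x.2.2⟩

theorem card_range_alloc_le {h : ℕ → ℕ}
    (hh : ∀ t P, #{a : Fin (m + 1) × Fin (2 ^ (m + 1)) × Bool |
      s.loc t a.1 a.2 = P ∧ s.loc (t + 1) a.1 a.2 ≠ P} ≤ 2 * h t)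
    (hp : (p : ℝ) ≤ 2 * 2 ^ (m + 1) / Real.exp 1) (T : ℕ) :
    (Nat.card (Set.range fun (σ : Fin m → Fin (2 ^ (m + 1)) → Bool) a =>
        s.alloc (extend σ) a T) : ℝ) ≤
      Real.exp (2 * (∑ t ∈ range T, h t : ℕ) * (p * Real.log (2 * 2 ^ (m + 1) / p))) := by
  induction T with
  | zero =>
    simp only [alloc_zero, range_zero, sum_empty, Nat.cast_zero, mul_zero, zero_mul, Real.exp_zero]
    -- At time 0 each packet is where its level-0 node is evaluated, whatever the switches.
    exact_mod_cast Finite.card_le_one_iff_subsingleton.2 (Set.subsingleton_coe _ |>.2 (by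
      rintro _ ⟨_, rfl⟩ _ ⟨_, rfl⟩
      rfl))
  | succ T ih =>
    refine (card_range_alloc_succ_le (hh T) hp).trans ?_
    refine (mul_le_mul_of_nonneg_right ih (Real.exp_pos _).le).trans_eq ?_
    rw [← Real.exp_add, sum_range_succ]
    congr 1
    push_cast
    ring

theorem two_pow_le {h : ℕ → ℕ}
    (hh : ∀ t P, #{a : Fin (m + 1) × Fin (2 ^ (m + 1)) × Bool |
      s.loc t a.1 a.2 = P ∧ s.loc (t + 1) a.1 a.2 ≠ P} ≤ 2 * h t)
    (hp : (p : ℝ) ≤ 2 * 2 ^ (m + 1) / Real.exp 1) {T : ℕ}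
    (hT : ∀ w, ∀ l ≤ m + 1, s.time w l < T) {q : ℕ}
    (hq : ∀ P, #{w | s.proc w (m + 1) = P} ≤ q) :
    (2 : ℝ) ^ (2 ^ (m + 1) * m) ≤
      Real.exp (2 * (∑ t ∈ range T, h t : ℕ) * (p * Real.log (2 * 2 ^ (m + 1) / p))) *
        (2 * q) ^ (2 * 2 ^ (m + 1)) := by
  classical
  let f := fun (σ : Fin m → Fin (2 ^ (m + 1)) → Bool) a => s.alloc (extend σ) a T
  have hfib : ∀ P, #{x : Fin (2 ^ (m + 1)) × Bool | s.proc (arcTo m x.1 x.2) (m + 1) = P} ≤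
      2 * q := fun P => by
    have h1 := card_le_card_of_injOn
      (s := {x : Fin (2 ^ (m + 1)) × Bool | s.proc (arcTo m x.1 x.2) (m + 1) = P})
      (t := ({w | s.proc w (m + 1) = P} : Finset (Fin (2 ^ (m + 1)))) ×ˢ (univ : Finset Bool))
      (fun x => (arcTo m x.1 x.2, x.2)) (fun x hx => by simpa using hx) (by
        rintro ⟨w, b⟩ _ ⟨w', b'⟩ _ h
        obtain ⟨h1, h2⟩ := Prod.ext_iff.1 h
        obtain rfl : b = b' := h2
        exact Prod.ext (arcTo_injective m b h1) rfl)
    rw [card_product, card_univ, Fintype.card_bool] at h1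
    have := hq P
    omega
  have h1 : #(univ : Finset (Fin m → Fin (2 ^ (m + 1)) → Bool)) ≤
      (2 * q) ^ (2 * 2 ^ (m + 1)) * #(univ.image f) := by
    refine card_le_mul_card_image _ _ fun β _ => ?_
    calc #{σ | f σ = β}
        ≤ #(Fintype.piFinset fun a : Fin (2 ^ (m + 1)) × Bool =>
            {x : Fin (2 ^ (m + 1)) × Bool | s.proc (arcTo m x.1 x.2) (m + 1) = β a}) := by
          -- A setting is recovered from the final arcs of its packets, and the allocation `β`
          -- confines each final arc to those whose output end is evaluated by `β a`.
          refine card_le_card_of_injOn (fun σ a => route (extend σ) a m) (fun σ hσ => ?_)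
            route_extend_injective.injOn
          have hσ' : f σ = β := (mem_filter.1 hσ).2
          simp only [Fintype.coe_piFinset, Set.mem_pi, coe_filter, mem_univ, true_and,
            Set.mem_ofPred_eq, Set.mem_univ, forall_const]
          intro a
          rw [← hσ', ← alloc_of_forall_lt (ht := hT)]
      _ ≤ _ := by
          rw [Fintype.card_piFinset]
          refine (prod_le_pow_card _ _ _ fun a _ => hfib _).trans_eq ?_
          simp [mul_comm]
  have h2 : #(univ.image f) = Nat.card (Set.range f) := by
    rw [Nat.card_coe_set_eq, ← Set.ncard_coe_finset]
    simp
  have h3 : #(univ : Finset (Fin m → Fin (2 ^ (m + 1)) → Bool)) = 2 ^ (2 ^ (m + 1) * m) := by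
    simp [pow_mul]
  rw [h2, h3] at h1
  calc (2 : ℝ) ^ (2 ^ (m + 1) * m)
      ≤ (2 * q) ^ (2 * 2 ^ (m + 1)) * Nat.card (Set.range f) := by exact_mod_cast h1
    _ ≤ _ := by
        rw [mul_comm]
        exact mul_le_mul_of_nonneg_right (card_range_alloc_le hh hp T) (by positivity)

end Schedule

end FFT

/-! ### From executions to schedules; messages forced by disjoint paths. -/

namespace FFT

open Finset BSP BSP.Execution

variable {k p : ℕ}

/-- The node in row `w` of level `l ≤ k`. -/
def node (w : Fin (2 ^ k)) (l : ℕ) : FFTNode k := (w, ⟨min l k, by omega⟩)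

theorem fftArc_node {l : ℕ} (hl : l < k) (w : Fin (2 ^ k)) (b : Bool) :
    FFTArc k (node w l) (node (arcTo l w b) (l + 1)) := by
  have h1 : node w l = (w, ⟨l, by omega⟩) := Prod.ext rfl (Fin.ext (min_eq_left hl.le))
  have h2 : node (arcTo l w b) (l + 1) = (arcTo l w b, ⟨l + 1, by omega⟩) :=
    Prod.ext rfl (Fin.ext (min_eq_left hl))
  rw [h1, h2]
  exact fftArc_arcTo hl w b

theorem node_inj {w w' : Fin (2 ^ k)} {l l' : ℕ} (hl : l ≤ k) (hl' : l' ≤ k)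
    (h : node w l = node w' l') : w = w' ∧ l = l' := by
  simp only [node, Prod.mk.injEq, Fin.mk.injEq] at h
  omega

theorem isOutput_fftDAG_iff (v : FFTNode k) : (fftDAG k).IsOutput v ↔ v = node v.1 k := by
  constructor
  · intro h
    by_contra hne
    have hlt : (v.2 : ℕ) < k := by
      refine lt_of_le_of_ne (Nat.le_of_lt_succ v.2.2) fun h => hne ?_
      exact Prod.ext rfl (Fin.ext (by simp [node, h]))
    exact h _ (fftArc_arcTo hlt v.1 false)
  · rintro h w hw
    have h1 : (w.2 : ℕ) = v.2 + 1 := hw.1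
    rw [h] at h1
    simp only [node, min_self] at h1
    omega

/-- `s` describes when and where the nodes are evaluated in the execution `A`. -/
structure Schedule.Describes (s : Schedule k p) (A : Execution p (FFTNode k)) : Prop where
  evaluatedAt_iff : ∀ w, ∀ l ≤ k, ∀ t P,
    A.EvaluatedAt (node w l) t P ↔ t = s.time w l ∧ P = s.proc w l
  sendsAt : ∀ l < k, ∀ w b t, s.loc t l (w, b) ≠ s.loc (t + 1) l (w, b) →
    A.SendsAt (node w l) t (s.loc t l (w, b)) (s.loc (t + 1) l (w, b))

theorem exists_schedule_describes {A : Execution p (FFTNode k)}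
    (hA : A.EvaluatesWithoutRecomputation (fftDAG k)) : ∃ s : Schedule k p, s.Describes A := by
  obtain ⟨τ, π, hτ, harc⟩ := exists_schedule hA
  have hL : ∀ l w b, ∃ L : ℕ → Fin p, l < k → A.IsTrajectory (node w l) (τ (node w l))
      (π (node w l)) (τ (node (arcTo l w b) (l + 1))) (π (node (arcTo l w b) (l + 1))) L :=
    fun l w b => by
      by_cases hl : l < k
      · obtain ⟨L, hL⟩ := (harc _ _ (fftArc_node hl w b)).2
        exact ⟨L, fun _ => hL⟩
      · exact ⟨fun _ => π (node w l), fun h => absurd h hl⟩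
  choose L hL using hL
  exact ⟨{
    time := fun w l => τ (node w l)
    proc := fun w l => π (node w l)
    loc := fun t l a => L l a.1 a.2 t
    time_le := fun l hl w b => (harc _ _ (fftArc_node hl w b)).1
    loc_of_le := fun l hl w b => (hL l w b hl).depart
    loc_of_ge := fun l hl w b => (hL l w b hl).arrive },
    fun w l _ => hτ (node w l), fun l hl w b => (hL l w b hl).move⟩

namespace Schedule.Describes

variable {s : Schedule k p} {A : Execution p (FFTNode k)} (hs : s.Describes A)

include hs

theorem time_lt (w : Fin (2 ^ k)) (l : ℕ) (hl : l ≤ k) : s.time w l < A.steps.length :=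
  ((hs.evaluatedAt_iff w l hl _ _).2 ⟨rfl, rfl⟩).1

theorem ncard_outputsOf (P : Fin p) :
    (A.outputsOf (fftDAG k) P).ncard = #{w | s.proc w k = P} := by
  have h : A.outputsOf (fftDAG k) P =
      (fun w => node w k) '' ({w | s.proc w k = P} : Finset (Fin (2 ^ k))) := by
    ext v
    simp only [outputsOf, isOutput_fftDAG_iff, Set.mem_ofPred_eq, coe_filter, mem_univ, true_and,
      Set.mem_image]
    constructor
    · rintro ⟨h1, st, hst, hv⟩
      obtain ⟨t, ht, rfl⟩ := List.getElem_of_mem hst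
      rw [h1] at hv
      exact ⟨v.1, ((hs.evaluatedAt_iff _ _ le_rfl _ _).1 ⟨ht, hv⟩).2.symm, h1.symm⟩
    · rintro ⟨w, rfl, rfl⟩
      obtain ⟨ht, hw⟩ := (hs.evaluatedAt_iff w k le_rfl _ _).2 ⟨rfl, rfl⟩
      exact ⟨rfl, _, List.getElem_mem ht, hw⟩
  rw [h, Set.ncard_image_of_injective _ fun a b h => (node_inj le_rfl le_rfl h).1,
    Set.ncard_coe_finset]

/-- The factor 2 is the out-degree: one message with the value of a node can serve both arcs leaving
it. -/
theorem card_moves_le (t : ℕ) (P : Fin p) :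
    #{a : Fin k × Fin (2 ^ k) × Bool | s.loc t a.1 a.2 = P ∧ s.loc (t + 1) a.1 a.2 ≠ P} ≤
      2 * A.degreeAt t := by
  classical
  set M : Finset (Fin k × Fin (2 ^ k) × Bool) :=
    {a | s.loc t a.1 a.2 = P ∧ s.loc (t + 1) a.1 a.2 ≠ P} with hM
  have h1 : #(M.image fun a => node a.2.1 a.1) ≤ A.degreeAt t := by
    refine A.card_sent_le_degreeAt _ t P fun u hu => ?_
    obtain ⟨a, ha, rfl⟩ := mem_image.1 hu
    obtain ⟨ha1, ha2⟩ := (mem_filter.1 ha).2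
    have := hs.sendsAt a.1 a.1.2 a.2.1 a.2.2 t (fun h => ha2 (h.symm.trans ha1))
    exact ⟨_, ha1 ▸ this⟩
  have h2 := card_le_card_of_injOn (s := M)
    (t := (M.image fun a => node a.2.1 a.1) ×ˢ (univ : Finset Bool))
    (fun a => (node a.2.1 a.1, a.2.2))
    (fun a ha => by
      simp only [coe_product, Set.mem_prod, coe_univ, Set.mem_univ, and_true]
      exact mem_coe.2 (mem_image_of_mem _ ha))
    (by
      rintro ⟨l, w, b⟩ _ ⟨l', w', b'⟩ _ h
      obtain ⟨h1, h2⟩ := Prod.ext_iff.1 h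
      obtain ⟨h3, h4⟩ := node_inj l.2.le l'.2.le h1
      exact Prod.ext (Fin.ext h4) (Prod.ext h3 h2))
  rw [card_product, card_univ, Fintype.card_bool] at h2
  omega

/-- A path whose ends are evaluated on different sides of a bipartition of the processors contains a
node whose value is sent across. -/
theorem exists_sendsAt (c : Fin p → Prop) (v : ℕ → Fin (2 ^ k)) (b : ℕ → Bool)
    (hv : ∀ l < k, v (l + 1) = arcTo l (v l) (b l))
    (h0 : c (s.proc (v 0) 0)) (hk : ¬ c (s.proc (v k) k)) :
    ∃ l < k, ∃ t R R', c R ∧ ¬ c R' ∧ A.SendsAt (node (v l) l) t R R' := by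
  have hcross : ∃ l < k, c (s.proc (v l) l) ∧ ¬ c (s.proc (v (l + 1)) (l + 1)) := by
    by_contra! hcon
    have : ∀ l ≤ k, c (s.proc (v l) l) := fun l => by
      induction l with
      | zero => exact fun _ => h0
      | succ l ih => exact fun hl => hcon l hl (ih (Nat.le_of_succ_le hl))
    exact hk (this k le_rfl)
  obtain ⟨l, hl, h1, h2⟩ := hcross
  rw [hv l hl] at h2
  have htraj : A.IsTrajectory (node (v l) l) (s.time (v l) l) (s.proc (v l) l)
      (s.time (arcTo l (v l) (b l)) (l + 1)) (s.proc (arcTo l (v l) (b l)) (l + 1))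
      (fun t => s.loc t l (v l, b l)) :=
    ⟨s.loc_of_le l hl _ _, s.loc_of_ge l hl _ _, hs.sendsAt l hl _ _⟩
  exact ⟨l, hl, htraj.exists_sendsAt_of_ne (s.time_le l hl _ _) c h1 h2⟩

/-- The path from `w` to `xorBits w x` is at `xorBits w (x % 2 ^ l)` on level `l`. For fixed `x`
these paths are node-disjoint, so distinct crossing paths force distinct values across. -/
theorem card_cross_le (c : Fin p → Prop) [DecidablePred c] {H : ℕ}
    (hH : ∀ S : Finset (FFTNode k),
      (∀ u ∈ S, ∃ t R R', c R ∧ ¬ c R' ∧ A.SendsAt u t R R') → #S ≤ H) (x : Fin (2 ^ k)) :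
    #{w | c (s.proc w 0) ∧ ¬ c (s.proc (xorBits w x) k)} ≤ H := by
  classical
  set W : Finset (Fin (2 ^ k)) := {w | c (s.proc w 0) ∧ ¬ c (s.proc (xorBits w x) k)} with hW
  have hpath : ∀ w ∈ W, ∃ l < k, ∃ t R R', c R ∧ ¬ c R' ∧
      A.SendsAt (node (xorBits w (x % 2 ^ l)) l) t R R' := fun w hw => by
    obtain ⟨h0, hk⟩ := (mem_filter.1 hw).2
    refine hs.exists_sendsAt c (fun l => xorBits w (x % 2 ^ l)) (fun l => (x : ℕ).testBit l)
      (fun l _ => xorBits_mod_two_pow_succ w x l) ?_ ?_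
    · simpa [Nat.mod_one, xorBits_zero] using h0
    · simpa [Nat.mod_eq_of_lt x.2] using hk
  choose! l hl hsend using hpath
  rw [← card_image_of_injOn (f := fun w => node (xorBits w (x % 2 ^ l w)) (l w))]
  · refine hH _ fun u hu => ?_
    obtain ⟨w, hw, rfl⟩ := mem_image.1 hu
    exact hsend w hw
  · intro w hw w' hw' h
    obtain ⟨h1, h2⟩ := node_inj (hl w hw).le (hl w' hw').le h
    rw [h2] at h1
    exact xorBits_injective _ h1

/-- Double counting: each pair of an input row and an output row is joined by the path of exactly
one `x`. -/
theorem card_mul_card_le (c : Fin p → Prop) [DecidablePred c] {H : ℕ}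
    (hH : ∀ S : Finset (FFTNode k),
      (∀ u ∈ S, ∃ t R R', c R ∧ ¬ c R' ∧ A.SendsAt u t R R') → #S ≤ H) :
    #{w | c (s.proc w 0)} * #{w | ¬ c (s.proc w k)} ≤ 2 ^ k * H := by
  have hfib : ∀ w, #{x : Fin (2 ^ k) | ¬ c (s.proc (xorBits w x) k)} =
      #{w | ¬ c (s.proc w k)} := fun w =>
    card_bijective (fun x : Fin (2 ^ k) => xorBits w x)
      (Finite.injective_iff_bijective.1 (xorBits_left_injective w)) (by simp)
  calc #{w | c (s.proc w 0)} * #{w | ¬ c (s.proc w k)}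
      = ∑ w with c (s.proc w 0), #{x : Fin (2 ^ k) | ¬ c (s.proc (xorBits w x) k)} := by
        rw [sum_congr rfl fun w _ => hfib w, sum_const, smul_eq_mul]
    _ = ∑ x : Fin (2 ^ k), #{w | c (s.proc w 0) ∧ ¬ c (s.proc (xorBits w x) k)} := by
        simp only [card_filter]
        rw [sum_comm]
        refine sum_congr rfl fun x _ => ?_
        rw [sum_filter]
        refine sum_congr rfl fun w _ => ?_
        split_ifs <;> simp_all
    _ ≤ ∑ _x : Fin (2 ^ k), H := sum_le_sum fun x _ => hs.card_cross_le c hH x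
    _ = 2 ^ k * H := by simp

/-- The number of outputs that a processor evaluates bounds its communication. -/
theorem min_le_commComplexity (P : Fin p) {q : ℕ} (hq : #{w | s.proc w k = P} = q) :
    min (q : ℝ) ((2 : ℝ) ^ k - q) / 2 ≤ A.commComplexity := by
  set x := #{w | s.proc w 0 = P} with hx
  have h1 := hs.card_mul_card_le (fun R => R = P) (H := A.commComplexity) fun S hS =>
    A.card_sent_le_commComplexity S P fun u hu => by
      obtain ⟨t, R, R', rfl, -, h⟩ := hS u hu
      exact ⟨t, R', h⟩
  have h2 := hs.card_mul_card_le (fun R => R ≠ P) (H := A.commComplexity) fun S hS =>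
    A.card_received_le_commComplexity S P fun u hu => by
      obtain ⟨t, R, R', -, hR', h⟩ := hS u hu
      exact ⟨t, R, not_not.1 hR' ▸ h⟩
  simp only [not_not, ne_eq] at h1 h2
  have h3 : x + #{w | ¬ s.proc w 0 = P} = 2 ^ k := by
    rw [hx, card_filter_add_card_filter_not]
    simp
  have h4 : q + #{w | ¬ s.proc w k = P} = 2 ^ k := by
    rw [← hq, card_filter_add_card_filter_not]
    simp
  rw [hq] at h2
  have h1' : (x : ℝ) * (2 ^ k - q) ≤ 2 ^ k * A.commComplexity := by
    have h4' : ((2 : ℝ) ^ k - q) = (#{w | ¬ s.proc w k = P} : ℕ) := by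
      rw [sub_eq_iff_eq_add']
      exact_mod_cast h4.symm
    rw [h4']
    exact_mod_cast h1
  have h2' : ((2 : ℝ) ^ k - x) * q ≤ 2 ^ k * A.commComplexity := by
    have h3' : ((2 : ℝ) ^ k - x) = (#{w | ¬ s.proc w 0 = P} : ℕ) := by
      rw [sub_eq_iff_eq_add']
      exact_mod_cast h3.symm
    rw [h3']
    exact_mod_cast h2
  have hqn : (q : ℝ) ≤ 2 ^ k := by exact_mod_cast (by omega : q ≤ 2 ^ k)
  have hn : (0 : ℝ) < 2 ^ k := by positivity
  have hq0 : (0 : ℝ) ≤ q := by positivity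
  generalize (2 : ℝ) ^ k = n at *
  -- If `P` evaluates `x ≤ q` inputs, enough paths lead into `P`; otherwise enough lead out of it.
  have h5 : (n - q) * q ≤ n * A.commComplexity := by
    rcases le_total (x : ℝ) q with h | h
    · exact (mul_le_mul_of_nonneg_right (by linarith) hq0).trans h2'
    · rw [mul_comm]
      exact (mul_le_mul_of_nonneg_right h (by linarith)).trans h1'
  -- The larger of `q` and `n - q` is at least `n / 2`.
  have h6 : n * (min (q : ℝ) (n - q) / 2) ≤ (n - q) * q := by
    rcases le_total (q : ℝ) (n - q) with h | h
    · rw [min_eq_left h]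
      nlinarith
    · rw [min_eq_right h]
      nlinarith
  exact le_of_mul_le_mul_left (h6.trans h5) hn

theorem card_outputs_le_maxOutputs (P : Fin p) :
    #{w | s.proc w k = P} ≤ A.maxOutputs (fftDAG k) := by
  rw [← hs.ncard_outputsOf P]
  exact le_sup (f := fun P : Fin p => (A.outputsOf (fftDAG k) P).ncard) (mem_univ P)

theorem exists_card_outputs_eq_maxOutputs :
    ∃ P, #{w | s.proc w k = P} = A.maxOutputs (fftDAG k) := by
  have : Nonempty (Fin p) := ⟨s.proc ⟨0, by positivity⟩ 0⟩
  obtain ⟨P, -, hP⟩ := exists_mem_eq_sup (univ : Finset (Fin p)) univ_nonempty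
    fun P : Fin p => (A.outputsOf (fftDAG k) P).ncard
  exact ⟨P, (hs.ncard_outputsOf P).symm.trans hP.symm⟩

theorem two_pow_le_mul_maxOutputs : 2 ^ k ≤ p * A.maxOutputs (fftDAG k) := by
  calc 2 ^ k = ∑ P : Fin p, #{w | s.proc w k = P} := by
        rw [← card_eq_sum_card_fiberwise fun _ _ => mem_univ _]
        simp
    _ ≤ ∑ _P : Fin p, A.maxOutputs (fftDAG k) :=
        sum_le_sum fun P _ => hs.card_outputs_le_maxOutputs P
    _ = _ := by simp

end Schedule.Describes

/-- The bound given by the number of permutations that the FFT DAG realizes. -/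
theorem mul_logb_le {m q : ℕ} {s : Schedule (m + 1) p} {A : Execution p (FFTNode (m + 1))}
    (hs : s.Describes A) (hp : (p : ℝ) ≤ 2 * 2 ^ (m + 1) / Real.exp 1)
    (hq : q = A.maxOutputs (fftDAG (m + 1))) (hq0 : 0 < q) :
    (2 : ℝ) ^ (m + 1) * m ≤ 2 * p * A.commComplexity * Real.logb 2 (2 * 2 ^ (m + 1) / p) +
      2 * 2 ^ (m + 1) * Real.logb 2 (2 * q) := by
  have h := Schedule.two_pow_le (fun t P => hs.card_moves_le t P) hp hs.time_lt
    (q := q) (fun P => hq ▸ hs.card_outputs_le_maxOutputs P)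
  rw [sum_degreeAt] at h
  have hq1 : (0 : ℝ) < 2 * q := by positivity
  have h1 := Real.log_le_log (by positivity) h
  rw [Real.log_mul (Real.exp_pos _).ne' (by positivity), Real.log_exp, Real.log_pow,
    Real.log_pow] at h1
  have h2 : 0 < Real.log 2 := Real.log_pos (by norm_num)
  simp only [Real.logb]
  rw [mul_div_assoc', mul_div_assoc', ← add_div, le_div_iff₀ h2]
  push_cast at h1
  linarith

end FFT

/-! ### Real inequalities that combine the two bounds, and the theorem. -/

/-- For `y ≥ e`, the function `y / log y` is increasing. -/
theorem logb_mul_div_le {y z : ℝ} (hy : Real.exp 1 ≤ y) (hz : Real.logb 2 y ≤ z) :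
    Real.logb 2 (y * z / Real.logb 2 y) ≤ z := by
  have hy0 : 0 < y := (Real.exp_pos 1).trans_le hy
  have hlog : 1 ≤ Real.log y := by rwa [Real.le_log_iff_exp_le hy0]
  have h2 : 0 < Real.log 2 := Real.log_pos (by norm_num)
  have hL : 0 < Real.logb 2 y := div_pos (by linarith) h2
  have hz0 : 0 < z := hL.trans_le hz
  rw [mul_div_assoc, Real.logb_mul hy0.ne' (by positivity)]
  have h3 : Real.logb 2 (z / Real.logb 2 y) ≤ z - Real.logb 2 y := by
    rw [Real.logb, div_le_iff₀ h2]
    refine (Real.log_le_sub_one_of_pos (by positivity)).trans ?_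
    have h4 : Real.logb 2 y * Real.log 2 = Real.log y := by
      rw [Real.logb, div_mul_cancel₀ _ h2.ne']
    rw [sub_mul, h4, sub_le_iff_le_add, div_le_iff₀ hL]
    have h5 : 0 ≤ (z - Real.logb 2 y) * (Real.log y - 1) :=
      mul_nonneg (by linarith) (by linarith)
    rw [← h4] at h5 ⊢
    nlinarith
  linarith

theorem fft_bounds_of_logb_bounds {n p q H : ℝ} (hp0 : 0 < p) (hq0 : 0 < q) (hn : 0 < n)
    (hp : p ≤ 2 * n / Real.exp 1) (hpq : n ≤ p * q) (hmin : min q (n - q) / 2 ≤ H)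
    (hcount : n * Real.logb 2 (n / 2) ≤
      2 * p * H * Real.logb 2 (2 * n / p) + 2 * n * Real.logb 2 (2 * q)) :
    H ≥ n * Real.logb 2 (n / (8 * q ^ 2)) / (4 * p * Real.logb 2 (2 * n / p)) +
        min q (n - q) / 4 ∧
      (q ≤ n / 2 → H > n * Real.logb 2 (n / 2) / (8 * p * Real.logb 2 (2 * n / p))) := by
  have hy : Real.exp 1 ≤ 2 * n / p := by
    rw [le_div_iff₀ hp0, mul_comm]
    rwa [le_div_iff₀ (Real.exp_pos 1)] at hp
  have hy1 : 1 < 2 * n / p := (Real.one_lt_exp_iff.2 one_pos).trans_le hy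
  have hL : 0 < Real.logb 2 (2 * n / p) := Real.logb_pos (by norm_num) hy1
  have hlog : Real.logb 2 (n / (8 * q ^ 2)) = Real.logb 2 (n / 2) - 2 * Real.logb 2 (2 * q) := by
    have : n / (8 * q ^ 2) = n / 2 / (2 * q) ^ 2 := by
      field_simp
      ring
    rw [this, Real.logb_div (by positivity) (by positivity), Real.logb_pow]
    norm_num
  have hmono := fun z => logb_mul_div_le (z := z) hy
  rw [hlog]
  generalize hLdef : Real.logb 2 (2 * n / p) = L at *
  generalize hMdef : Real.logb 2 (n / 2) = M at *
  constructor
  · have h1 : n * (M - 2 * Real.logb 2 (2 * q)) / (4 * p * L) ≤ H / 2 := by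
      rw [div_le_iff₀ (by positivity)]
      linarith
    linarith
  · intro hqn
    rw [min_eq_left (by linarith)] at hmin
    rw [gt_iff_lt, div_lt_iff₀ (by positivity)]
    have hpL : 0 < p * L := mul_pos hp0 hL
    -- For large `q` the bound `q / 2 ≤ H` suffices. For small `q`, monotonicity of `y / log y`
    -- turns `q ≤ n * M / (4 * p * L)` into `log (2q) ≤ M / 4`, so the `q` term takes at most half
    -- of the counting bound.
    rcases lt_or_ge (n * M) (4 * (p * L) * q) with h | h
    · nlinarith
    -- Some processor evaluates at least the average number of outputs, so `n ≤ p * q`; this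
    -- supplies the hypothesis of `logb_mul_div_le`.
    · have hML : L ≤ M / 4 := by
        have h1 : 4 * L * n ≤ 4 * L * (p * q) := by gcongr
        have h2 : n * (4 * L) ≤ n * M := by linarith
        have := le_of_mul_le_mul_left h2 hn
        linarith
      have h3 : 2 * q ≤ 2 * n / p * (M / 4) / L := by
        rw [le_div_iff₀ hL, div_mul_eq_mul_div, le_div_iff₀ hp0]
        linarith
      have h4 : Real.logb 2 (2 * q) ≤ M / 4 :=
        (Real.logb_le_logb_of_le (by norm_num) (by positivity) h3).trans (hmono _ hML)
      have hM : 0 < n * M := mul_pos hn (by linarith)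
      have h5 : 2 * n * Real.logb 2 (2 * q) ≤ 2 * n * (M / 4) := by gcongr
      linarith

theorem theorem3 (k n p q : ℕ) (hn : n = 2 ^ k)
    (hp : (p : ℝ) ≤ 2 * (n : ℝ) / Real.exp 1)
    (A : BSP.Execution p (FFTNode k))
    (hA : A.EvaluatesWithoutRecomputation (fftDAG k))
    (hin : A.InputsAtUniqueProcessor (fftDAG k))
    (hq : q = A.maxOutputs (fftDAG k)) :
    (A.commComplexity : ℝ) ≥
        (n : ℝ) * Real.logb 2 ((n : ℝ) / (8 * (q : ℝ) ^ 2)) /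
            (4 * (p : ℝ) * Real.logb 2 (2 * (n : ℝ) / (p : ℝ))) +
          min (q : ℝ) ((n : ℝ) - (q : ℝ)) / 4 ∧
      ((q : ℝ) ≤ (n : ℝ) / 2 →
        (A.commComplexity : ℝ) >
          (n : ℝ) * Real.logb 2 ((n : ℝ) / 2) /
            (8 * (p : ℝ) * Real.logb 2 (2 * (n : ℝ) / (p : ℝ)))) := by
  subst hn
  obtain ⟨s, hs⟩ := FFT.exists_schedule_describes hA
  have hpq := hs.two_pow_le_mul_maxOutputs
  rw [← hq] at hpq
  have hpos : 0 < p * q := lt_of_lt_of_le (by positivity) hpq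
  have hp0 : 0 < p := Nat.pos_of_mul_pos_right hpos
  have hq0 : 0 < q := Nat.pos_of_mul_pos_left hpos
  obtain ⟨P, hP⟩ := hs.exists_card_outputs_eq_maxOutputs
  have hmin := hs.min_le_commComplexity P (hP.trans hq.symm)
  push_cast at hp ⊢
  refine fft_bounds_of_logb_bounds (by exact_mod_cast hp0) (by exact_mod_cast hq0) (by positivity)
    hp (by exact_mod_cast hpq) hmin ?_
  cases k with
  -- For `n = 1` the bound `p ≤ 2 / e < 1` contradicts the existence of a processor.
  | zero =>
    have h1 : (1 : ℝ) ≤ p := by exact_mod_cast hp0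
    have h2 : (2 : ℝ) * 2 ^ 0 / Real.exp 1 < 1 := by
      rw [div_lt_one (Real.exp_pos 1)]
      linarith [Real.exp_one_gt_d9]
    linarith
  | succ m =>
    have hm : Real.logb 2 ((2 : ℝ) ^ (m + 1) / 2) = m := by
      rw [pow_succ, mul_div_cancel_right₀ _ two_ne_zero, Real.logb_pow]
      simp
    rw [hm]
    exact FFT.mul_logb_le hs hp hq hq0
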